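/- Let $\Lambda$ and $H$ be countable discrete groups such that $\Lambda$ has at least two elements, and let $\Lambda\wr H=\bigl(\bigoplus_{h\in H}\Lambda\bigr)\rtimes H$ be their (restricted) wreath product, where $\bigoplus_{h\in H}\Lambda$ is the group of finitely supported functions $H\to\Lambda$ and $H$ acts on it by shifting the indices. A discrete group $G$ is called maximally almost periodic (MAP) if its irreducible finite-dimensional unitary representations $G\to U(n)$ separate the points of $G$, and residually finite (RF) if the intersection of its normal subgroups of finite index is trivial. (i) $\Lambda\wr H$ is MAP if and only if $\Lambda$ is MAP, $H$ is RF, and either $H$ is finite or $\Lambda$ is abelian. (ii) $\Lambda\wr H$ is RF if and only if $\Lambda$ and $H$ are both RF, and either $H$ is finite or $\Lambda$ is abelian. -/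

import Mathlib

/-- The restricted direct sum `⨁_{h ∈ H} Λ`: the group of finitely supported functions `H → Λ`
with pointwise multiplication. -/
def finSuppPower (Λ H : Type*) [Group Λ] : Subgroup (H → Λ) where
  carrier := {f | (Function.mulSupport f).Finite}
  one_mem' := by simp
  mul_mem' {f g} hf hg := (Set.Finite.union hf hg).subset (Function.mulSupport_mul f g)
  inv_mem' {f} hf := by
    simpa only [Set.mem_ofPred_eq, Function.mulSupport_inv] using hf

theorem mem_finSuppPower {Λ H : Type*} [Group Λ] {f : H → Λ} :
    f ∈ finSuppPower Λ H ↔ (Function.mulSupport f).Finite :=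
  Iff.rfl

theorem shift_mem_finSuppPower {Λ H : Type*} [Group Λ] [Group H] (a : H) {f : H → Λ}
    (hf : f ∈ finSuppPower Λ H) : (fun h => f (a * h)) ∈ finSuppPower Λ H :=
  Set.Finite.preimage (Set.injOn_of_injective (mul_right_injective a)) hf

/-- The action of `H` on `⨁_{h ∈ H} Λ` by shifting the indices: `(a • f) h = f (a⁻¹ h)`. -/
def shiftAction (Λ H : Type*) [Group Λ] [Group H] : H →* MulAut (finSuppPower Λ H) where
  toFun a :=
    { toFun := fun f => ⟨fun h => f.1 (a⁻¹ * h), shift_mem_finSuppPower a⁻¹ f.2⟩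
      invFun := fun f => ⟨fun h => f.1 (a * h), shift_mem_finSuppPower a f.2⟩
      left_inv := fun f => by ext h; simp
      right_inv := fun f => by ext h; simp
      map_mul' := fun f g => by ext h; rfl }
  map_one' := by ext f h; simp
  map_mul' a b := by ext f h; simp [mul_assoc]

/-- The (restricted) wreath product `Λ ≀ H = (⨁_{h ∈ H} Λ) ⋊ H`. -/
abbrev RestrictedWreathProduct (Λ H : Type*) [Group Λ] [Group H] : Type _ :=
  finSuppPower Λ H ⋊[shiftAction Λ H] H

/-- The linear representation on `ℂⁿ` given by a homomorphism `σ : G → U(n)`. -/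
noncomputable def unitaryToRepresentation {G : Type*} [Group G] {n : ℕ}
    (σ : G →* Matrix.unitaryGroup (Fin n) ℂ) : Representation ℂ G (Fin n → ℂ) :=
  ((Matrix.toLinAlgEquiv' : Matrix (Fin n) (Fin n) ℂ ≃ₐ[ℂ] _) :
    Matrix (Fin n) (Fin n) ℂ →* ((Fin n → ℂ) →ₗ[ℂ] (Fin n → ℂ))).comp
    ((Matrix.unitaryGroup (Fin n) ℂ).subtype.comp σ)

/-- A (discrete) group is maximally almost periodic (MAP) if its irreducible finite dimensional
unitary representations separate its points. -/
def IsMaximallyAlmostPeriodic (G : Type*) [Group G] : Prop :=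
  ∀ x y : G, x ≠ y → ∃ (n : ℕ) (σ : G →* Matrix.unitaryGroup (Fin n) ℂ),
    (unitaryToRepresentation σ).IsIrreducible ∧ σ x ≠ σ y

/-!
Write `G = Λ ≀ H`. The embedding of `Λ` in `G` as the factor at `1` passes both properties from `G`
to `Λ`, and residually finite groups are MAP, so necessity only concerns a MAP group `G`.

* Let `H` be infinite. For `a b : Λ`, the conjugates of `a` and of `b` by distinct elements of `H`
  commute. In a finite-dimensional unitary representation the centralizers of more and more
  conjugates of `b` form a descending chain of subspaces, which becomes stationary, and this forces
  some conjugate of `a` to commute with the same conjugate of `b`. Hence `Λ` is abelian.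
* Let `Λ` be abelian. The conjugates of `a : Λ` commute with each other, so their images in a
  unitary representation are simultaneously diagonalizable with the same finite set of eigenvalues,
  and there are only finitely many of them. The centralizer of the image of `a` thus has a preimage
  of finite index, whereas a nontrivial `k : H` does not commute with `a`. Hence `H` is residually
  finite.

Conversely, if `H` is finite, unitary representations of `Λ` induce monomial representations of `G`
that detect the base group, and the base group has finite index in `G`. If `Λ` is abelian and `H`
residually finite, multiplying along the fibers of `H → H ⧸ N` defines a homomorphism
`Λ ≀ H → Λ ≀ (H ⧸ N)`. It does not kill a given nontrivial element if `N` separates `1`, its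
component in `H` and the points of its support, which reduces the claim to finite `H`.
-/

section Isometries

variable {𝕜 V : Type*} [RCLike 𝕜] [NormedAddCommGroup V] [InnerProductSpace 𝕜 V]
  [FiniteDimensional 𝕜 V] {u : Module.End 𝕜 V}

theorem orthogonal_mem_invtSubmodule_of_norm_map (hu : ∀ v, ‖u v‖ = ‖v‖) {p : Submodule 𝕜 V}
    (hp : p ∈ u.invtSubmodule) : pᗮ ∈ u.invtSubmodule := by
  have inner_map := (LinearMap.norm_map_iff_inner_map_map u).mp hu
  have u_injective : Function.Injective u := (AddMonoidHomClass.isometry_of_norm u hu).injective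
  have map_eq : p.map u = p :=
    Submodule.eq_of_le_of_finrank_eq (Submodule.map_le_iff_le_comap.mpr hp)
      (p.equivMapOfInjective u u_injective).finrank_eq.symm
  intro v hv w hw
  obtain ⟨w', hw', rfl⟩ := map_eq.ge hw
  exact (inner_map w' v).trans (hv w' hw')

theorem isSemisimple_of_norm_map (hu : ∀ v, ‖u v‖ = ‖v‖) : u.IsSemisimple :=
  Module.End.isSemisimple_iff.mpr fun p hp =>
    ⟨pᗮ, orthogonal_mem_invtSubmodule_of_norm_map hu hp, p.isCompl_orthogonal⟩

theorem mem_unitary_iff_norm_map : u ∈ unitary (V →ₗ[𝕜] V) ↔ ∀ v, ‖u v‖ = ‖v‖ := by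
  rw [LinearMap.norm_map_iff_inner_map_map u, Unitary.mem_iff, mul_eq_one_comm (a := u), and_self,
    LinearMap.star_eq_adjoint]
  constructor
  · intro hu v w
    rw [← LinearMap.adjoint_inner_right, ← Module.End.mul_apply, hu, Module.End.one_apply]
  · intro hu
    refine LinearMap.ext fun w => ext_inner_left 𝕜 fun v => ?_
    rw [Module.End.mul_apply, LinearMap.adjoint_inner_right, hu, Module.End.one_apply]

end Isometries

section CommutingEndomorphisms

open Polynomial

variable {ι K V : Type*} [Field K] [AddCommGroup V] [Module K V] [FiniteDimensional K V]
  {f : ι → Module.End K V}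

theorem iSup_iInf_eigenspace_eq_top [IsAlgClosed K]
    (hcomm : Pairwise fun i j => Commute (f i) (f j)) (hss : ∀ i, (f i).IsSemisimple) :
    ⨆ χ : ι → K, ⨅ i, (f i).eigenspace (χ i) = ⊤ := by
  simpa only [fun i μ => (hss i).isFinitelySemisimple.maxGenEigenspace_eq_eigenspace μ] using
    Module.End.iSup_iInf_maxGenEigenspace_eq_top_of_iSup_maxGenEigenspace_eq_top_of_commute f
      hcomm fun i => Module.End.iSup_maxGenEigenspace_eq_top (f i)

theorem finite_iInf_eigenspace_ne_bot (hcomm : Pairwise fun i j => Commute (f i) (f j)) :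
    {χ : ι → K | ⨅ i, (f i).eigenspace (χ i) ≠ ⊥}.Finite := by
  have commute_all (i j) : Commute (f i) (f j) := by
    rcases eq_or_ne i j with rfl | hij
    exacts [.refl _, hcomm hij]
  have indep := Module.End.independent_iInf_maxGenEigenspace_of_forall_mapsTo f fun i j =>
    Module.End.mapsTo_maxGenEigenspace_of_comm (commute_all j i)
  refine (WellFoundedGT.finite_ne_bot_of_iSupIndep indep).subset fun χ hχ h => hχ ?_
  exact eq_bot_mono (iInf_mono fun i => (f i).genEigenspace_le_maximal (χ i) 1) h

theorem finite_range_of_pairwise_commute [IsAlgClosed K]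
    (hcomm : Pairwise fun i j => Commute (f i) (f j)) (hss : ∀ i, (f i).IsSemisimple)
    {p : K[X]} (hp : p ≠ 0) (hpf : ∀ i, aeval (f i) p = 0) : (Set.range f).Finite := by
  let W : Set (ι → K) := {χ | ⨅ i, (f i).eigenspace (χ i) ≠ ⊥}
  have : Finite W := finite_iInf_eigenspace_ne_bot hcomm
  have mem_rootSet (χ : W) (i : ι) : χ.1 i ∈ p.rootSet K := by
    obtain ⟨v, hv, hv0⟩ := Submodule.exists_mem_ne_zero_of_ne_bot χ.2
    have eval_smul := Module.End.aeval_apply_of_hasEigenvector (p := p)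
      ⟨(Submodule.mem_iInf _).mp hv i, hv0⟩
    rw [hpf, LinearMap.zero_apply, eq_comm, smul_eq_zero_iff_left hv0] at eval_smul
    exact (mem_rootSet_of_ne hp).mpr (by rwa [coe_aeval_eq_eval])
  let eigenvalues (i : ι) (χ : W) : p.rootSet K := ⟨χ.1 i, mem_rootSet χ i⟩
  have f_eq {i j : ι} (hij : eigenvalues i = eigenvalues j) : f i = f j := by
    rw [← LinearMap.eqLocus_eq_top, ← top_le_iff, ← iSup_iInf_eigenspace_eq_top hcomm hss]
    refine iSup_le fun χ v hv => ?_
    have map_eq (k : ι) : f k v = χ k • v :=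
      Module.End.mem_eigenspace_iff.mp ((Submodule.mem_iInf _).mp hv k)
    rcases eq_or_ne v 0 with rfl | hv0
    · exact zero_mem _
    · have hχ : χ ∈ W := Submodule.ne_bot_iff _ |>.mpr ⟨v, hv, hv0⟩
      have χ_eq : χ i = χ j := congrArg Subtype.val (congrFun hij ⟨χ, hχ⟩)
      rw [LinearMap.mem_eqLocus, map_eq, map_eq, χ_eq]
  exact (Set.finite_range (Function.extend eigenvalues f 0)).subset <|
    Set.range_subset_iff.mpr fun i =>
      ⟨eigenvalues i, Function.FactorsThrough.extend_apply (fun _ _ => f_eq) 0 i⟩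

end CommutingEndomorphisms

theorem exists_commute_of_pairwise_commute {K R : Type*} [CommRing K] [Ring R] [Algebra K R]
    [IsArtinian K R] {x y : ℕ → R} (h : Pairwise fun i j => Commute (x i) (y j)) :
    ∃ i, Commute (x i) (y i) := by
  let C (k : ℕ) : Submodule K R := (Subalgebra.centralizer K (y '' Set.Iio k)).toSubmodule
  have mem_C {k : ℕ} {m : R} : m ∈ C k ↔ ∀ i < k, Commute (y i) m := by
    simp [C, Subalgebra.mem_centralizer_iff, commute_iff_eq]
  have C_antitone : Antitone C := fun k l hkl m hm =>
    mem_C.mpr fun i hi => mem_C.mp hm i (hi.trans_le hkl)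
  obtain ⟨n, hn⟩ := IsArtinian.monotone_stabilizes
    (⟨fun k => OrderDual.toDual (C k), C_antitone⟩ : ℕ →o (Submodule K R)ᵒᵈ)
  have C_eq_succ : C n = C (n + 1) := hn (n + 1) n.le_succ
  have hx : x n ∈ C n := mem_C.mpr fun i hi => (h hi.ne').symm
  exact ⟨n, (mem_C.mp (C_eq_succ ▸ hx) n n.lt_succ_self).symm⟩

section UnitaryRepresentations

theorem isIrreducible_iff_of_equiv {k G V W : Type*} [Field k] [Monoid G] [AddCommGroup V]
    [Module k V] [AddCommGroup W] [Module k W] {ρ : Representation k G V}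
    {σ : Representation k G W} (e : ρ.Equiv σ) : ρ.IsIrreducible ↔ σ.IsIrreducible := by
  simp only [Representation.irreducible_iff_isSimpleModule_asModule]
  exact (LinearEquiv.ofBijective
    (Representation.IntertwiningMap.equivLinearMapAsModule ρ σ e.toIntertwiningMap)
    e.toLinearEquiv.bijective).isSimpleModule_iff

/-- A representation on an inner product space is unitary if every group element acts
isometrically. -/
def IsUnitaryRepresentation {G V : Type*} [Group G] [NormedAddCommGroup V]
    [InnerProductSpace ℂ V] (ρ : Representation ℂ G V) : Prop :=
  ∀ g v, ‖ρ g v‖ = ‖v‖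

/-- The standard unitary representation of `U(n)` on the Hilbert space `ℂⁿ`. Unlike
`unitaryToRepresentation`, it is on `EuclideanSpace`, whose norm the unitary matrices preserve. -/
noncomputable def standardRepresentation (n : Type*) [Fintype n] [DecidableEq n] :
    Representation ℂ (Matrix.unitaryGroup n ℂ) (EuclideanSpace ℂ n) :=
  ((LinearMap.toMatrixOrthonormal (EuclideanSpace.basisFun n ℂ)).symm : Matrix n n ℂ →* _).comp
    (Matrix.unitaryGroup n ℂ).subtype

theorem standardRepresentation_injective (n : Type*) [Fintype n] [DecidableEq n] :
    Function.Injective (standardRepresentation n) :=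
  (LinearMap.toMatrixOrthonormal (EuclideanSpace.basisFun n ℂ)).symm.injective.comp
    Subtype.val_injective

theorem isUnitaryRepresentation_standardRepresentation (n : Type*) [Fintype n] [DecidableEq n] :
    IsUnitaryRepresentation (standardRepresentation n) := fun u =>
  mem_unitary_iff_norm_map.mp <|
    Unitary.map_mem (LinearMap.toMatrixOrthonormal (EuclideanSpace.basisFun n ℂ)).symm u.2

/-- The left regular representation of a finite group `G`, on the Hilbert space with orthonormal
basis `G`. -/
noncomputable def regularRepresentation (G : Type*) [Group G] [Fintype G] :
    Representation ℂ G (EuclideanSpace ℂ G) where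
  toFun g := (LinearIsometryEquiv.piLpCongrLeft 2 ℂ ℂ (Equiv.mulLeft g)).toLinearEquiv
  map_one' := by
    ext v k
    change v (1⁻¹ * k) = v k
    rw [inv_one, one_mul]
  map_mul' g h := by
    ext v k
    change v ((g * h)⁻¹ * k) = v (h⁻¹ * (g⁻¹ * k))
    rw [mul_inv_rev, mul_assoc]

theorem regularRepresentation_apply {G : Type*} [Group G] [Fintype G] (g : G)
    (v : EuclideanSpace ℂ G) (k : G) : regularRepresentation G g v k = v (g⁻¹ * k) :=
  rfl

theorem regularRepresentation_injective (G : Type*) [Group G] [Fintype G] :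
    Function.Injective (regularRepresentation G) := by
  classical
  rw [injective_iff_map_eq_one]
  intro g hg
  by_contra ne_one
  have apply_single := congrArg (· g)
    (LinearMap.congr_fun hg (EuclideanSpace.single (1 : G) (1 : ℂ)))
  simp [regularRepresentation_apply, ne_one] at apply_single

theorem isUnitaryRepresentation_regularRepresentation (G : Type*) [Group G] [Fintype G] :
    IsUnitaryRepresentation (regularRepresentation G) := fun g =>
  (LinearIsometryEquiv.piLpCongrLeft 2 ℂ ℂ (Equiv.mulLeft g)).norm_map

namespace IsUnitaryRepresentation

variable {G V : Type*} [Group G] [NormedAddCommGroup V] [InnerProductSpace ℂ V]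
  {ρ : Representation ℂ G V}

theorem comp {K : Type*} [Group K] (hρ : IsUnitaryRepresentation ρ) (f : K →* G) :
    IsUnitaryRepresentation (ρ.comp f) := fun k => hρ (f k)

theorem restrict (hρ : IsUnitaryRepresentation ρ) (U : Subrepresentation ρ) :
    IsUnitaryRepresentation U.toRepresentation := fun g v => hρ g v

variable [FiniteDimensional ℂ V]

/-- The orthogonal complement of a subrepresentation of a finite-dimensional unitary
representation. -/
noncomputable def orthogonal (hρ : IsUnitaryRepresentation ρ) (U : Subrepresentation ρ) :
    Subrepresentation ρ where
  toSubmodule := U.toSubmoduleᗮ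
  apply_mem_toSubmodule g :=
    orthogonal_mem_invtSubmodule_of_norm_map (hρ g) (U.apply_mem_toSubmodule g)

/-- A unitary representation on `V` as a homomorphism to `U(dim V)`, by means of an orthonormal
basis of `V`. -/
noncomputable def toUnitaryGroup (hρ : IsUnitaryRepresentation ρ) :
    G →* Matrix.unitaryGroup (Fin (Module.finrank ℂ V)) ℂ where
  toFun g := ⟨LinearMap.toMatrixOrthonormal (stdOrthonormalBasis ℂ V) (ρ g),
    Unitary.map_mem _ (mem_unitary_iff_norm_map.mpr (hρ g))⟩
  map_one' := by ext1; simp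
  map_mul' g h := Subtype.ext (by simp only [map_mul, Submonoid.coe_mul])

/-- The coordinates in the orthonormal basis chosen in `toUnitaryGroup`, as an isomorphism of
representations. -/
noncomputable def equivToUnitaryGroup (hρ : IsUnitaryRepresentation ρ) :
    ρ.Equiv (unitaryToRepresentation hρ.toUnitaryGroup) :=
  let b := (stdOrthonormalBasis ℂ V).toBasis
  .mk b.equivFun fun g => LinearMap.ext fun v => (LinearMap.toMatrix_mulVec_repr b b (ρ g) v).symm

theorem toUnitaryGroup_apply_eq_one_iff (hρ : IsUnitaryRepresentation ρ) {g : G} :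
    hρ.toUnitaryGroup g = 1 ↔ ρ g = 1 := by
  rw [Subtype.ext_iff]
  exact map_eq_one_iff _
    (EquivLike.injective (LinearMap.toMatrixOrthonormal (stdOrthonormalBasis ℂ V)))

theorem apply_eq_one_of_restrict_eq_one (hρ : IsUnitaryRepresentation ρ) {U : Subrepresentation ρ}
    {x : G} (hU : U.toRepresentation x = 1) (hU' : (hρ.orthogonal U).toRepresentation x = 1) :
    ρ x = 1 := by
  refine LinearMap.ext fun v => ?_
  obtain ⟨u, hu, w, hw, rfl⟩ := U.toSubmodule.exists_add_mem_mem_orthogonal v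
  have map_u : ρ x u = u := congrArg Subtype.val (LinearMap.congr_fun hU ⟨u, hu⟩)
  have map_w : ρ x w = w := congrArg Subtype.val (LinearMap.congr_fun hU' ⟨w, hw⟩)
  rw [map_add, map_u, map_w, Module.End.one_apply]

theorem exists_subrepresentation_apply_ne_one (hρ : IsUnitaryRepresentation ρ)
    (reducible : ¬ρ.IsIrreducible) {x : G} (hx : ρ x ≠ 1) :
    ∃ U : Subrepresentation ρ, U.toSubmodule ≠ ⊤ ∧ U.toRepresentation x ≠ 1 := by
  obtain ⟨U, ne_bot, ne_top⟩ : ∃ U : Subrepresentation ρ, U ≠ ⊥ ∧ U ≠ ⊤ := by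
    contrapose! reducible
    have bot_ne_top : (⊥ : Subrepresentation ρ) ≠ ⊤ := fun h => hx <| LinearMap.ext fun v => by
      have hv : v = 0 := (h.ge : ⊤ ≤ (⊥ : Subrepresentation ρ)) (Submodule.mem_top (x := v))
      simp only [hv, map_zero]
    exact { exists_pair_ne := ⟨⊥, ⊤, bot_ne_top⟩
            eq_bot_or_eq_top := fun U => or_iff_not_imp_left.mpr (reducible U) }
  by_cases hU : U.toRepresentation x = 1
  · refine ⟨hρ.orthogonal U, fun h => ne_bot ?_, mt (hρ.apply_eq_one_of_restrict_eq_one hU) hx⟩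
    have toSubmodule_eq_bot : U.toSubmodule = ⊥ := (Submodule.orthogonal_eq_top_iff _).mp h
    exact Subrepresentation.toSubmodule_injective toSubmodule_eq_bot
  · exact ⟨U, fun h => ne_top (Subrepresentation.toSubmodule_injective h), hU⟩

theorem exists_isIrreducible_apply_ne_one (hρ : IsUnitaryRepresentation ρ) {x : G}
    (hx : ρ x ≠ 1) :
    ∃ (n : ℕ) (σ : G →* Matrix.unitaryGroup (Fin n) ℂ),
      (unitaryToRepresentation σ).IsIrreducible ∧ σ x ≠ 1 := by
  induction hd : Module.finrank ℂ V using Nat.strong_induction_on generalizing V with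
  | _ d ih
  by_cases irreducible : ρ.IsIrreducible
  · exact ⟨_, hρ.toUnitaryGroup, (isIrreducible_iff_of_equiv hρ.equivToUnitaryGroup).mp irreducible,
      hρ.toUnitaryGroup_apply_eq_one_iff.not.mpr hx⟩
  · obtain ⟨U, ne_top, hU⟩ := hρ.exists_subrepresentation_apply_ne_one irreducible hx
    exact ih _ (hd ▸ Submodule.finrank_lt ne_top) (hρ.restrict U) hU rfl

end IsUnitaryRepresentation

end UnitaryRepresentations

section ResidualFiniteness

variable {G K : Type*} [Group G] [Group K]

theorem residuallyFinite_of_forall_exists_monoidHom.{u}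
    (h : ∀ g : G, g ≠ 1 → ∃ (K : Type u) (_ : Group K) (_ : Group.ResiduallyFinite K)
      (f : G →* K), f g ≠ 1) : Group.ResiduallyFinite G := by
  rw [Group.residuallyFinite_iff_exists_finiteIndexNormalSubgroup]
  intro g hg
  obtain ⟨K, _, _, f, hf⟩ := h g hg
  obtain ⟨N, hN⟩ := Group.exists_finiteIndexNormalSubgroup_notMem (f g) hf
  exact ⟨N.comap f, hN⟩

theorem residuallyFinite_of_injective [hK : Group.ResiduallyFinite K] (f : G →* K)
    (hf : Function.Injective f) : Group.ResiduallyFinite G :=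
  residuallyFinite_of_forall_exists_monoidHom fun _ hg =>
    ⟨K, inferInstance, hK, f, (map_ne_one_iff f hf).mpr hg⟩

theorem residuallyFinite_of_finiteIndex (L : Subgroup G) [L.FiniteIndex]
    [Group.ResiduallyFinite L] : Group.ResiduallyFinite G := by
  rw [Group.residuallyFinite_iff_exists_finiteIndex]
  intro g hg
  by_cases hgL : g ∈ L
  · obtain ⟨N, hN⟩ := Group.exists_finiteIndexNormalSubgroup_notMem (⟨g, hgL⟩ : L)
      (mt (congrArg Subtype.val) hg)
    refine ⟨N.toSubgroup.map L.subtype, ?_, fun h => hN ?_⟩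
    · rw [Subgroup.finiteIndex_iff, Subgroup.index_map_subtype]
      exact mul_ne_zero Subgroup.FiniteIndex.index_ne_zero Subgroup.FiniteIndex.index_ne_zero
    · obtain ⟨x, hx, rfl⟩ := h
      exact hx
  · exact ⟨L, inferInstance, hgL⟩

theorem exists_finiteIndexNormalSubgroup_injOn [Group.ResiduallyFinite G] {S : Set G}
    (hS : S.Finite) :
    ∃ N : FiniteIndexNormalSubgroup G, Set.InjOn (QuotientGroup.mk' N.toSubgroup) S := by
  have : Finite S.offDiag := hS.offDiag
  choose N hN using fun p : S.offDiag => Group.exists_finiteIndexNormalSubgroup_notMem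
    (p.1.1⁻¹ * p.1.2) (inv_mul_eq_one.not.mpr p.2.2.2)
  have normal : (⨅ p, (N p).toSubgroup).Normal := Subgroup.normal_iInf_normal fun _ => inferInstance
  have finiteIndex : (⨅ p, (N p).toSubgroup).FiniteIndex :=
    Subgroup.finiteIndex_iInf fun _ => inferInstance
  refine ⟨.ofSubgroup (⨅ p, (N p).toSubgroup), fun x hx y hy hxy => ?_⟩
  by_contra ne
  exact hN ⟨(x, y), hx, hy, ne⟩ (Subgroup.mem_iInf.mp (QuotientGroup.eq.mp hxy) _)

end ResidualFiniteness

section VonNeumannKernel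

/-- The von Neumann kernel of a group: the elements killed by all of its finite-dimensional
unitary representations. -/
def vonNeumannKernel (G : Type*) [Group G] : Subgroup G :=
  ⨅ (n : ℕ) (σ : G →* Matrix.unitaryGroup (Fin n) ℂ), σ.ker

variable {G K : Type*} [Group G] [Group K]

theorem mem_vonNeumannKernel {x : G} :
    x ∈ vonNeumannKernel G ↔ ∀ (n : ℕ) (σ : G →* Matrix.unitaryGroup (Fin n) ℂ), σ x = 1 := by
  simp only [vonNeumannKernel, Subgroup.mem_iInf, MonoidHom.mem_ker]

theorem map_mem_vonNeumannKernel (f : G →* K) {x : G} (hx : x ∈ vonNeumannKernel G) :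
    f x ∈ vonNeumannKernel K :=
  mem_vonNeumannKernel.mpr fun n σ => mem_vonNeumannKernel.mp hx n (σ.comp f)

theorem IsUnitaryRepresentation.apply_eq_one_of_mem_vonNeumannKernel {V : Type*}
    [NormedAddCommGroup V] [InnerProductSpace ℂ V] [FiniteDimensional ℂ V]
    {ρ : Representation ℂ G V} (hρ : IsUnitaryRepresentation ρ) {x : G}
    (hx : x ∈ vonNeumannKernel G) : ρ x = 1 :=
  hρ.toUnitaryGroup_apply_eq_one_iff.mp (mem_vonNeumannKernel.mp hx _ _)

theorem isMaximallyAlmostPeriodic_iff_vonNeumannKernel_eq_bot :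
    IsMaximallyAlmostPeriodic G ↔ vonNeumannKernel G = ⊥ := by
  rw [Subgroup.eq_bot_iff_forall]
  constructor
  · intro hG x hx
    by_contra ne_one
    obtain ⟨n, σ, -, hσ⟩ := hG x 1 ne_one
    exact hσ (by rw [mem_vonNeumannKernel.mp hx, map_one])
  · intro hG x y hxy
    obtain ⟨n, σ, hσ⟩ : ∃ (n : ℕ) (σ : G →* Matrix.unitaryGroup (Fin n) ℂ), σ (x / y) ≠ 1 := by
      have := mt (hG (x / y)) (div_eq_one.not.mpr hxy)
      simpa only [mem_vonNeumannKernel, not_forall] using this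
    have unitary := (isUnitaryRepresentation_standardRepresentation (Fin n)).comp σ
    obtain ⟨m, τ, irreducible, hτ⟩ := unitary.exists_isIrreducible_apply_ne_one
      ((map_ne_one_iff _ (standardRepresentation_injective (Fin n))).mpr hσ)
    refine ⟨m, τ, irreducible, fun h => hτ ?_⟩
    rw [map_div, h, div_self']

theorem isMaximallyAlmostPeriodic_of_forall_exists_monoidHom.{u}
    (h : ∀ g : G, g ≠ 1 → ∃ (K : Type u) (_ : Group K) (_ : IsMaximallyAlmostPeriodic K)
      (f : G →* K), f g ≠ 1) : IsMaximallyAlmostPeriodic G := by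
  rw [isMaximallyAlmostPeriodic_iff_vonNeumannKernel_eq_bot, Subgroup.eq_bot_iff_forall]
  intro g hg
  by_contra ne_one
  obtain ⟨K, _, hK, f, hf⟩ := h g ne_one
  rw [isMaximallyAlmostPeriodic_iff_vonNeumannKernel_eq_bot, Subgroup.eq_bot_iff_forall] at hK
  exact hf (hK _ (map_mem_vonNeumannKernel f hg))

theorem IsMaximallyAlmostPeriodic.of_injective (hK : IsMaximallyAlmostPeriodic K) (f : G →* K)
    (hf : Function.Injective f) : IsMaximallyAlmostPeriodic G :=
  isMaximallyAlmostPeriodic_of_forall_exists_monoidHom fun _ hg =>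
    ⟨K, inferInstance, hK, f, (map_ne_one_iff f hf).mpr hg⟩

theorem isMaximallyAlmostPeriodic_of_finite [Finite G] : IsMaximallyAlmostPeriodic G := by
  have := Fintype.ofFinite G
  rw [isMaximallyAlmostPeriodic_iff_vonNeumannKernel_eq_bot, Subgroup.eq_bot_iff_forall]
  intro g hg
  refine regularRepresentation_injective G ?_
  rw [map_one]
  exact (isUnitaryRepresentation_regularRepresentation G).apply_eq_one_of_mem_vonNeumannKernel hg

theorem isMaximallyAlmostPeriodic_of_residuallyFinite [Group.ResiduallyFinite G] :
    IsMaximallyAlmostPeriodic G :=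
  isMaximallyAlmostPeriodic_of_forall_exists_monoidHom fun g hg =>
    have ⟨N, hN⟩ := Group.exists_finiteIndexNormalSubgroup_notMem g hg
    ⟨G ⧸ N.toSubgroup, inferInstance, isMaximallyAlmostPeriodic_of_finite,
      QuotientGroup.mk' N.toSubgroup, (QuotientGroup.eq_one_iff g).not.mpr hN⟩

end VonNeumannKernel

section Obstructions

variable {G K : Type*} [Group G] [Group K]

theorem IsMaximallyAlmostPeriodic.commute_of_pairwise_commute_conj
    (hG : IsMaximallyAlmostPeriodic G) {a b : G} {s : ℕ → G}
    (hs : Pairwise fun i j => Commute (s i * a * (s i)⁻¹) (s j * b * (s j)⁻¹)) :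
    Commute a b := by
  by_contra not_commute
  obtain ⟨n, σ, -, hσ⟩ := hG (a * b) (b * a) not_commute
  let m : G →* Matrix (Fin n) (Fin n) ℂ := (Matrix.unitaryGroup (Fin n) ℂ).subtype.comp σ
  obtain ⟨i, hi⟩ := exists_commute_of_pairwise_commute (K := ℂ)
    (x := fun i => m (s i * a * (s i)⁻¹)) (y := fun i => m (s i * b * (s i)⁻¹))
    fun i j hij => (hs hij).map m
  have commute_conj : Commute (σ (s i * a * (s i)⁻¹)) (σ (s i * b * (s i)⁻¹)) := Subtype.ext hi
  rw [map_mul, map_mul, map_mul, map_mul, map_inv, Commute.conj_iff] at commute_conj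
  exact hσ (by rw [map_mul, map_mul, commute_conj.eq])

theorem finiteIndex_comap_centralizer (f : G →* K) {a : K}
    (h : (Set.range fun x => f x * a * (f x)⁻¹).Finite) :
    ((Subgroup.centralizer {a}).comap f).FiniteIndex := by
  let _ : MulAction G K := MulAction.compHom K (MulAut.conj.comp f)
  have stabilizer_eq : MulAction.stabilizer G a = (Subgroup.centralizer {a}).comap f := by
    ext x
    rw [MulAction.mem_stabilizer_iff, Subgroup.mem_comap, Subgroup.mem_centralizer_singleton_iff]
    exact mul_inv_eq_iff_eq_mul
  have : (MulAction.orbit G a).Finite := h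
  rw [← stabilizer_eq, Subgroup.finiteIndex_iff, MulAction.index_stabilizer]
  exact (Set.ncard_pos this).mpr (MulAction.nonempty_orbit a) |>.ne'

theorem minpoly_map_conj {k A : Type*} [CommRing k] [Ring A] [Algebra k A] (f : G →* A) (x g : G) :
    minpoly k (f (x * g * x⁻¹)) = minpoly k (f g) := by
  let u : ConjAct Aˣ := ConjAct.toConjAct (f.toHomUnits x)
  have conj_eq : f (x * g * x⁻¹) = MulSemiringAction.toAlgEquiv k A u (f g) := by
    rw [map_mul, map_mul]
    rfl
  rw [conj_eq, minpoly.algEquiv_eq]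

theorem IsMaximallyAlmostPeriodic.exists_finiteIndexNormalSubgroup_notMem
    (hG : IsMaximallyAlmostPeriodic G) {g k : G}
    (hg : ∀ x y : G, Commute (x * g * x⁻¹) (y * g * y⁻¹)) (hk : ¬Commute k g) :
    ∃ N : FiniteIndexNormalSubgroup G, k ∉ N := by
  obtain ⟨n, σ, -, hσ⟩ := hG (k * g) (g * k) hk
  let ρ := (standardRepresentation (Fin n)).comp σ
  have semisimple (x : G) : Module.End.IsSemisimple (ρ x) :=
    isSemisimple_of_norm_map ((isUnitaryRepresentation_standardRepresentation (Fin n)).comp σ x)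
  have finite_range : (Set.range fun x => ρ (x * g * x⁻¹)).Finite :=
    finite_range_of_pairwise_commute (p := minpoly ℂ (ρ g)) (fun x y _ => (hg x y).map ρ)
      (fun _ => semisimple _) (minpoly.ne_zero (Algebra.IsIntegral.isIntegral _))
      fun x => minpoly_map_conj (k := ℂ) ρ x g ▸ minpoly.aeval ℂ _
  have finite_conj : (Set.range fun x => σ x * σ g * (σ x)⁻¹).Finite := by
    refine .of_finite_image ?_ (standardRepresentation_injective (Fin n)).injOn
    simp only [← Set.range_comp, ← map_inv, ← map_mul]
    exact finite_range
  let L : Subgroup G := (Subgroup.centralizer {σ g}).comap σ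
  have : L.FiniteIndex := finiteIndex_comap_centralizer σ finite_conj
  refine ⟨.ofSubgroup L.normalCore, fun hk => hσ ?_⟩
  have commute_map : σ k * σ g = σ g * σ k :=
    Subgroup.mem_centralizer_singleton_iff.mp (L.normalCore_le hk)
  rw [map_mul, map_mul, commute_map]

end Obstructions

namespace finSuppPower

variable {Λ M H Q : Type*} [Group Λ] [CommGroup M]

open Classical in
/-- The inclusion of `Λ` in `⨁_{h ∈ H} Λ` as the factor with index `h`. -/
noncomputable def single (h : H) : Λ →* finSuppPower Λ H where
  toFun a := ⟨Pi.mulSingle h a, (Set.finite_singleton h).subset Pi.mulSupport_mulSingle_subset⟩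
  map_one' := Subtype.ext (Pi.mulSingle_one h)
  map_mul' a b := Subtype.ext (Pi.mulSingle_mul (f := fun _ : H => Λ) h a b)

@[simp]
theorem single_apply_self (h : H) (a : Λ) : (single h a).1 h = a := by
  simp [single]

theorem single_apply_of_ne {h k : H} (hk : k ≠ h) (a : Λ) : (single h a).1 k = 1 := by
  simp [single, hk]

theorem single_injective (h : H) : Function.Injective (single h : Λ →* finSuppPower Λ H) :=
  fun a b hab => by simpa using congrArg (fun f => f.1 h) hab

theorem commute_single {h k : H} (hk : h ≠ k) (a b : Λ) :
    Commute (single h a : finSuppPower Λ H) (single k b) := by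
  ext l
  rcases eq_or_ne l h with rfl | hl
  · simp [single_apply_of_ne hk]
  · simp [single_apply_of_ne hl]

theorem shiftAction_single [Group H] (h k : H) (a : Λ) :
    shiftAction Λ H h (single k a) = single (h * k) a := by
  ext l
  change (single k a).1 (h⁻¹ * l) = _
  rcases eq_or_ne l (h * k) with rfl | hl
  · simp
  · rw [single_apply_of_ne hl, single_apply_of_ne (mt inv_mul_eq_iff_eq_mul.mp hl)]

instance [Group.ResiduallyFinite Λ] : Group.ResiduallyFinite (finSuppPower Λ H) :=
  residuallyFinite_of_forall_exists_monoidHom fun f hf =>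
    have ⟨h, hh⟩ : ∃ h, f.1 h ≠ 1 := Function.ne_iff.mp fun h => hf (Subtype.ext h)
    ⟨Λ, inferInstance, inferInstance, (Pi.evalMonoidHom _ h).comp (finSuppPower Λ H).subtype, hh⟩

/-- The homomorphism `⨁_{h ∈ H} M → ⨁_{k ∈ Q} M` multiplying the entries along the fibers of
`q : H → Q`. -/
noncomputable def fiberProd (q : H → Q) : finSuppPower M H →* finSuppPower M Q where
  toFun f := ⟨fun k => ∏ᶠ h : q ⁻¹' {k}, f.1 h, (f.2.image q).subset fun k hk => by
    by_contra not_mem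
    exact hk <| finprod_eq_one_of_forall_eq_one fun h : q ⁻¹' {k} =>
      by_contra fun hh => not_mem ⟨h.1, hh, h.2⟩⟩
  map_one' := by ext; simp
  map_mul' f g := by
    ext k
    exact finprod_mul_distrib (f.2.preimage Subtype.val_injective.injOn)
      (g.2.preimage Subtype.val_injective.injOn)

theorem fiberProd_apply (q : H → Q) (f : finSuppPower M H) (k : Q) :
    (fiberProd q f).1 k = ∏ᶠ h : q ⁻¹' {k}, f.1 h :=
  rfl

theorem fiberProd_apply_of_injOn {q : H → Q} {f : finSuppPower M H}
    (hq : Set.InjOn q (Function.mulSupport f.1)) {h : H} (hh : h ∈ Function.mulSupport f.1) :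
    (fiberProd q f).1 (q h) = f.1 h := by
  rw [fiberProd_apply]
  refine finprod_eq_single _ (⟨h, rfl⟩ : q ⁻¹' {q h}) fun k hk => ?_
  by_contra k_mem
  exact hk (Subtype.ext (hq k_mem hh k.2))

theorem fiberProd_shiftAction [Group H] [Group Q] (q : H →* Q) (a : H) (f : finSuppPower M H) :
    fiberProd q (shiftAction M H a f) = shiftAction M Q (q a) (fiberProd q f) := by
  ext k
  change ∏ᶠ h : q ⁻¹' {k}, f.1 (a⁻¹ * h) = ∏ᶠ h : q ⁻¹' {(q a)⁻¹ * k}, f.1 h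
  let shiftFiber : q ⁻¹' {k} ≃ q ⁻¹' {(q a)⁻¹ * k} :=
    (Equiv.mulLeft a⁻¹).subtypeEquiv fun h => by simp
  exact finprod_comp_equiv shiftFiber (f := fun h : q ⁻¹' {(q a)⁻¹ * k} => f.1 h)

end finSuppPower

theorem commute_conj_inl {N G : Type*} [CommGroup N] [Group G] {φ : G →* MulAut N}
    (x y : N ⋊[φ] G) (m n : N) :
    Commute (x * SemidirectProduct.inl m * x⁻¹) (y * SemidirectProduct.inl n * y⁻¹) := by
  have conj_mem (z : N ⋊[φ] G) (l : N) :
      z * SemidirectProduct.inl l * z⁻¹ ∈ (SemidirectProduct.inl : N →* N ⋊[φ] G).range := by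
    rw [SemidirectProduct.range_inl_eq_ker_rightHom]
    exact (MonoidHom.normal_ker _).conj_mem _ (SemidirectProduct.rightHom_inl l) z
  obtain ⟨m', hm'⟩ := conj_mem x m
  obtain ⟨n', hn'⟩ := conj_mem y n
  rw [← hm', ← hn']
  exact (Commute.all m' n').map _

namespace RestrictedWreathProduct

open SemidirectProduct (inl inr rightHom)

variable {Λ M H Q : Type*} [Group Λ] [CommGroup M] [Group H] [Group Q]

theorem inl_single_injective (h : H) :
    Function.Injective ((inl : _ →* RestrictedWreathProduct Λ H).comp (finSuppPower.single h)) :=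
  SemidirectProduct.inl_injective.comp (finSuppPower.single_injective h)

theorem inr_mul_inl_single_mul_inv (h k : H) (a : Λ) :
    (inr h * inl (finSuppPower.single k a) * (inr h)⁻¹ : RestrictedWreathProduct Λ H) =
      inl (finSuppPower.single (h * k) a) := by
  rw [← finSuppPower.shiftAction_single, SemidirectProduct.inl_aut, map_inv]

/-- The homomorphism of wreath products with a commutative base group induced by a homomorphism of
the acting groups. -/
noncomputable def mapActing (M : Type*) [CommGroup M] (q : H →* Q) :
    RestrictedWreathProduct M H →* RestrictedWreathProduct M Q :=
  SemidirectProduct.map (finSuppPower.fiberProd q) q fun a =>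
    MonoidHom.ext (finSuppPower.fiberProd_shiftAction q a)

theorem mapActing_ne_one {q : H →* Q} {g : RestrictedWreathProduct M H}
    (hq : Set.InjOn q (insert 1 (insert g.right (Function.mulSupport g.left.1)))) (hg : g ≠ 1) :
    mapActing M q g ≠ 1 := by
  intro map_eq_one
  have right_eq_one : g.right = 1 := by
    refine hq (by simp) (by simp) ?_
    rw [map_one]
    exact congrArg SemidirectProduct.right map_eq_one
  have left_ne_one : g.left ≠ 1 := fun h => hg (SemidirectProduct.ext h right_eq_one)
  obtain ⟨h, hh⟩ : ∃ h, g.left.1 h ≠ 1 := Function.ne_iff.mp fun h => left_ne_one (Subtype.ext h)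
  have map_left : (finSuppPower.fiberProd q g.left).1 (q h) = 1 :=
    congrArg (fun x => x.left.1 (q h)) map_eq_one
  rw [finSuppPower.fiberProd_apply_of_injOn (hq.mono (by grind)) hh] at map_left
  exact hh map_left

theorem exists_mapActing_ne_one [Group.ResiduallyFinite H] {g : RestrictedWreathProduct M H}
    (hg : g ≠ 1) :
    ∃ N : FiniteIndexNormalSubgroup H, mapActing M (QuotientGroup.mk' N.toSubgroup) g ≠ 1 := by
  obtain ⟨N, hN⟩ := exists_finiteIndexNormalSubgroup_injOn ((g.left.2.insert g.right).insert 1)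
  exact ⟨N, mapActing_ne_one hN hg⟩

section MonomialRepresentation

variable {V : Type*} [NormedAddCommGroup V] [InnerProductSpace ℂ V]
  {ρ : Representation ℂ Λ V}

variable (H) in
/-- The monomial representation of `Λ ≀ H` on `V^H`, induced by a representation of `Λ` on `V`:
the base group acts entrywise and `H` shifts the entries. -/
noncomputable def monomialRepresentation (ρ : Representation ℂ Λ V) :
    Representation ℂ (RestrictedWreathProduct Λ H) (PiLp 2 fun _ : H => V) where
  toFun g := (WithLp.linearEquiv 2 ℂ (H → V)).symm.conj <|
    LinearMap.pi fun k => ρ (g.left.1 k) ∘ₗ LinearMap.proj (g.right⁻¹ * k)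
  map_one' := by
    ext v k
    change ρ 1 (v (1⁻¹ * k)) = v k
    simp
  map_mul' g g' := by
    ext v k
    change ρ (g.left.1 k * g'.left.1 (g.right⁻¹ * k)) (v ((g.right * g'.right)⁻¹ * k)) =
      ρ (g.left.1 k) (ρ (g'.left.1 (g.right⁻¹ * k)) (v (g'.right⁻¹ * (g.right⁻¹ * k))))
    rw [map_mul, mul_inv_rev, mul_assoc, Module.End.mul_apply]

theorem monomialRepresentation_apply (g : RestrictedWreathProduct Λ H)
    (v : PiLp 2 fun _ : H => V) (k : H) :
    monomialRepresentation H ρ g v k = ρ (g.left.1 k) (v (g.right⁻¹ * k)) :=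
  rfl

theorem isUnitaryRepresentation_monomialRepresentation [Fintype H]
    (hρ : IsUnitaryRepresentation ρ) :
    IsUnitaryRepresentation (monomialRepresentation H ρ) := by
  intro g v
  simp only [PiLp.norm_eq_of_L2, monomialRepresentation_apply, hρ _ _]
  exact congrArg _ (Equiv.sum_comp (Equiv.mulLeft g.right⁻¹) fun k => ‖v k‖ ^ 2)

theorem apply_left_eq_one_of_monomialRepresentation_eq_one {g : RestrictedWreathProduct Λ H}
    (hg : monomialRepresentation H ρ g = 1) (right_eq_one : g.right = 1) (k : H) :
    ρ (g.left.1 k) = 1 := by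
  classical
  ext v
  have apply_single := congrArg (· k) (LinearMap.congr_fun hg (PiLp.single 2 k v))
  simpa [monomialRepresentation_apply, right_eq_one] using apply_single

end MonomialRepresentation

theorem isMaximallyAlmostPeriodic_of_finite [Finite H] (hΛ : IsMaximallyAlmostPeriodic Λ) :
    IsMaximallyAlmostPeriodic (RestrictedWreathProduct Λ H) := by
  have := Fintype.ofFinite H
  have hH := _root_.isMaximallyAlmostPeriodic_of_finite (G := H)
  rw [isMaximallyAlmostPeriodic_iff_vonNeumannKernel_eq_bot, Subgroup.eq_bot_iff_forall]
    at hΛ hH ⊢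
  intro g hg
  have right_eq_one : g.right = 1 := hH _ (map_mem_vonNeumannKernel rightHom hg)
  refine SemidirectProduct.ext (Subtype.ext (funext fun k => hΛ _ ?_)) right_eq_one
  refine mem_vonNeumannKernel.mpr fun n σ => standardRepresentation_injective (Fin n) ?_
  have unitary := (isUnitaryRepresentation_standardRepresentation (Fin n)).comp σ
  rw [map_one]
  exact apply_left_eq_one_of_monomialRepresentation_eq_one
    ((isUnitaryRepresentation_monomialRepresentation unitary).apply_eq_one_of_mem_vonNeumannKernel
      hg) right_eq_one k

theorem isMaximallyAlmostPeriodic_of_commGroup [Group.ResiduallyFinite H]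
    (hM : IsMaximallyAlmostPeriodic M) :
    IsMaximallyAlmostPeriodic (RestrictedWreathProduct M H) :=
  isMaximallyAlmostPeriodic_of_forall_exists_monoidHom fun _ hg =>
    have ⟨_, hN⟩ := exists_mapActing_ne_one hg
    ⟨_, _, isMaximallyAlmostPeriodic_of_finite hM, _, hN⟩

theorem finiteIndex_range_inl [Finite H] :
    (inl : _ →* RestrictedWreathProduct Λ H).range.FiniteIndex := by
  rw [SemidirectProduct.range_inl_eq_ker_rightHom]
  exact Subgroup.finiteIndex_ker _

theorem residuallyFinite_of_finite [Finite H] [Group.ResiduallyFinite Λ] :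
    Group.ResiduallyFinite (RestrictedWreathProduct Λ H) := by
  let base : Subgroup (RestrictedWreathProduct Λ H) := inl.range
  have : base.FiniteIndex := finiteIndex_range_inl
  have : Group.ResiduallyFinite base :=
    residuallyFinite_of_injective
      (MonoidHom.ofInjective SemidirectProduct.inl_injective).symm.toMonoidHom
      (MulEquiv.injective _)
  exact residuallyFinite_of_finiteIndex base

theorem residuallyFinite_of_commGroup [Group.ResiduallyFinite H]
    [Group.ResiduallyFinite M] : Group.ResiduallyFinite (RestrictedWreathProduct M H) :=
  residuallyFinite_of_forall_exists_monoidHom fun _ hg =>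
    have ⟨_, hN⟩ := exists_mapActing_ne_one hg
    ⟨_, _, residuallyFinite_of_finite, _, hN⟩

theorem commute_of_isMaximallyAlmostPeriodic [Infinite H]
    (h : IsMaximallyAlmostPeriodic (RestrictedWreathProduct Λ H)) (a b : Λ) : Commute a b := by
  let s (i : ℕ) : RestrictedWreathProduct Λ H := inr (Infinite.natEmbedding H i)
  refine .of_map (inl_single_injective (1 : H)) (h.commute_of_pairwise_commute_conj (s := s) ?_)
  intro i j hij
  simp only [s, MonoidHom.comp_apply, inr_mul_inl_single_mul_inv, mul_one]
  exact (finSuppPower.commute_single ((Infinite.natEmbedding H).injective.ne hij) a b).map inl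

theorem not_commute_inr_inl_single {k : H} (hk : k ≠ 1) {a : Λ} (ha : a ≠ 1) :
    ¬Commute (inr k : RestrictedWreathProduct Λ H) (inl (finSuppPower.single 1 a)) := by
  intro commute
  have conj_eq := inr_mul_inl_single_mul_inv k 1 a
  rw [commute.eq, mul_inv_cancel_right, mul_one] at conj_eq
  have apply_k := congrArg (fun f => f.1 k) (SemidirectProduct.inl_injective conj_eq)
  rw [finSuppPower.single_apply_self, finSuppPower.single_apply_of_ne hk] at apply_k
  exact ha apply_k.symm

theorem residuallyFinite_right_of_isMaximallyAlmostPeriodic [Nontrivial M]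
    (h : IsMaximallyAlmostPeriodic (RestrictedWreathProduct M H)) : Group.ResiduallyFinite H := by
  rw [Group.residuallyFinite_iff_exists_finiteIndexNormalSubgroup]
  intro k hk
  obtain ⟨a, ha⟩ := exists_ne (1 : M)
  obtain ⟨N, hN⟩ := h.exists_finiteIndexNormalSubgroup_notMem
    (fun x y => commute_conj_inl x y _ _) (not_commute_inr_inl_single hk ha)
  exact ⟨N.comap inr, hN⟩

end RestrictedWreathProduct

open RestrictedWreathProduct in
theorem mainTheorem6_general (Λ H : Type*) [Group Λ] [Group H] [Nontrivial Λ] :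
    (IsMaximallyAlmostPeriodic (RestrictedWreathProduct Λ H) ↔
      IsMaximallyAlmostPeriodic Λ ∧ Group.ResiduallyFinite H ∧
        (Finite H ∨ ∀ a b : Λ, a * b = b * a)) ∧
    (Group.ResiduallyFinite (RestrictedWreathProduct Λ H) ↔
      Group.ResiduallyFinite Λ ∧ Group.ResiduallyFinite H ∧
        (Finite H ∨ ∀ a b : Λ, a * b = b * a)) := by
  have necessary (h : IsMaximallyAlmostPeriodic (RestrictedWreathProduct Λ H)) :
      Group.ResiduallyFinite H ∧ (Finite H ∨ ∀ a b : Λ, a * b = b * a) := by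
    rcases finite_or_infinite H with hH | _
    · exact ⟨inferInstance, .inl hH⟩
    · have hΛ : ∀ a b : Λ, a * b = b * a := commute_of_isMaximallyAlmostPeriodic h
      let _ : CommGroup Λ := { ‹Group Λ› with mul_comm := hΛ }
      exact ⟨residuallyFinite_right_of_isMaximallyAlmostPeriodic h, .inr hΛ⟩
  have embedding := inl_single_injective (Λ := Λ) (1 : H)
  refine ⟨⟨fun h => ⟨h.of_injective _ embedding, necessary h⟩, ?_⟩,
    fun h => ⟨residuallyFinite_of_injective _ embedding,
      necessary isMaximallyAlmostPeriodic_of_residuallyFinite⟩, ?_⟩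
  all_goals rintro ⟨hΛ, hH, _ | comm⟩
  · exact isMaximallyAlmostPeriodic_of_finite hΛ
  · let _ : CommGroup Λ := { ‹Group Λ› with mul_comm := comm }
    exact isMaximallyAlmostPeriodic_of_commGroup hΛ
  · exact residuallyFinite_of_finite
  · let _ : CommGroup Λ := { ‹Group Λ› with mul_comm := comm }
    exact residuallyFinite_of_commGroup

theorem mainTheorem6 (Λ H : Type*) [Group Λ] [Group H] [Countable Λ] [Countable H]
    [Nontrivial Λ] :
    (IsMaximallyAlmostPeriodic (RestrictedWreathProduct Λ H) ↔
      IsMaximallyAlmostPeriodic Λ ∧ Group.ResiduallyFinite H ∧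
        (Finite H ∨ ∀ a b : Λ, a * b = b * a)) ∧
    (Group.ResiduallyFinite (RestrictedWreathProduct Λ H) ↔
      Group.ResiduallyFinite Λ ∧ Group.ResiduallyFinite H ∧
        (Finite H ∨ ∀ a b : Λ, a * b = b * a)) :=
  mainTheorem6_general Λ H
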